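/- Let $G$ be a locally compact second countable Hausdorff group. A subset $\Lambda \subset G$ is an approximate subgroup if $e \in \Lambda = \Lambda^{-1}$ and $\Lambda^2 \subset F\Lambda$ for some finite set $F \subset G$. It is called uniformly discrete (respectively a Delone set) if, for some proper left-invariant metric $d$ on $G$ inducing the topology of $G$, it is non-empty and there is $r>0$ with $d(x,y) \ge r$ for all distinct $x,y\in\Lambda$ (respectively if moreover there is $R>0$ such that the open $d$-balls of radius $R$ around the points of $\Lambda$ cover $G$). A uniform approximate lattice is an approximate subgroup which is a Delone set. A strong approximate lattice is a uniformly discrete approximate subgroup $\Lambda$ such that the hull $X_\Lambda = \overline{\{g\Lambda : g \in G\}}$, the closure being taken in the space of closed subsets of $G$ with the Chabauty–Fell topology, carries a Borel probability measure $\nu$ which is invariant under left translation by $G$ and satisfies $\nu(\{\emptyset\}) = 0$. Assume that either 1. $G$ contains a strong approximate lattice; or 2. $G$ contains a uniform approximate lattice and $G$ is compactly generated. Then $G$ is unimodular, that is, every left Haar measure on $G$ is also right-invariant. -/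

import Mathlib

open MeasureTheory Topology
open scoped Pointwise

namespace ApproxLattice

section MetricNotions

variable {X : Type*} [MetricSpace X]

/-- A non-empty subset of a metric space is `r`-uniformly discrete if any two distinct points of
it have distance at least `r`. -/
def MetricUniformlyDiscrete (r : ℝ) (A : Set X) : Prop :=
  A.Nonempty ∧ ∀ x ∈ A, ∀ y ∈ A, x ≠ y → r ≤ dist x y

/-- A non-empty subset of a metric space is `R`-relatively dense if the open balls of radius `R`
around its points cover the space. -/
def MetricRelativelyDense (R : ℝ) (A : Set X) : Prop :=
  A.Nonempty ∧ ⋃ x ∈ A, Metric.ball x R = Set.univ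

end MetricNotions

section Groups

variable {G : Type*} [Group G] [t : TopologicalSpace G]

/-- The metric `d` on the topological group `G` is left-invariant, proper (closed balls are
compact) and induces the given topology of `G`. -/
structure IsProperLeftInvariantMetric (d : MetricSpace G) : Prop where
  induces : d.toPseudoMetricSpace.toUniformSpace.toTopologicalSpace = t
  proper : @ProperSpace G d.toPseudoMetricSpace
  left_invariant : ∀ g x y : G, d.dist (g * x) (g * y) = d.dist x y

/-- Uniform discreteness in a topological group, with respect to some proper left-invariant
metric inducing the topology. -/
def IsUniformlyDiscrete (A : Set G) : Prop :=
  ∃ d : MetricSpace G, IsProperLeftInvariantMetric d ∧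
    ∃ r : ℝ, 0 < r ∧ @MetricUniformlyDiscrete G d r A

/-- Delone sets in a topological group: uniformly discrete and relatively dense with respect to
some proper left-invariant metric inducing the topology. -/
def IsDelone (A : Set G) : Prop :=
  ∃ d : MetricSpace G, IsProperLeftInvariantMetric d ∧
    (∃ r : ℝ, 0 < r ∧ @MetricUniformlyDiscrete G d r A) ∧
    (∃ R : ℝ, 0 < R ∧ @MetricRelativelyDense G d R A)

/-- Uniformly discrete subsets are closed, so that their hull is defined. -/
theorem IsUniformlyDiscrete.isClosed {A : Set G} (h : IsUniformlyDiscrete A) : IsClosed A := by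
  obtain ⟨d, hd, r, hr, -, hA⟩ := h
  have hind := hd.induces
  subst hind
  exact Metric.isClosed_of_pairwise_le_dist hr fun x hx y hy hxy => hA x hx y hy hxy

/-- A symmetric subset `A` containing the identity with `A ^ 2 ⊆ F * A` for some finite set `F`. -/
def IsApproxSubgroup (A : Set G) : Prop :=
  ∃ k : ℝ, IsApproximateSubgroup k A

/-- A uniform approximate lattice is an approximate subgroup which is a Delone set. -/
def IsUniformApproximateLattice (A : Set G) : Prop :=
  IsApproxSubgroup A ∧ IsDelone A

end Groups

/-- The space of all closed subsets of a topological space (to be equipped with the Chabauty-Fell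
topology). -/
@[ext]
structure ClosedSubsets (X : Type*) [TopologicalSpace X] where
  carrier : Set X
  isClosed : IsClosed carrier

namespace ClosedSubsets

variable {X : Type*} [TopologicalSpace X]

/-- The Chabauty-Fell topology, generated by the sets `{A | A ∩ K = ∅}`, `K` compact, and
`{A | A ∩ V ≠ ∅}`, `V` open. -/
instance : TopologicalSpace (ClosedSubsets X) :=
  TopologicalSpace.generateFrom
    ({U | ∃ K : Set X, IsCompact K ∧ U = {A | A.carrier ∩ K = ∅}} ∪
      {U | ∃ V : Set X, IsOpen V ∧ U = {A | (A.carrier ∩ V).Nonempty}})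

instance : MeasurableSpace (ClosedSubsets X) := borel _

instance : BorelSpace (ClosedSubsets X) := ⟨rfl⟩

variable {G : Type*} [Group G] [TopologicalSpace G] [IsTopologicalGroup G]

/-- The action of `G` on its closed subsets by left translation. -/
instance : MulAction G (ClosedSubsets G) where
  smul g A := ⟨g • A.carrier, A.isClosed.smul g⟩
  one_smul A := ClosedSubsets.ext (one_smul G A.carrier)
  mul_smul g h A := ClosedSubsets.ext (mul_smul g h A.carrier)

theorem carrier_smul (g : G) (A : ClosedSubsets G) : (g • A).carrier = g • A.carrier := rfl

theorem smul_inter_eq {H : Type*} [Group H] (g : H) (A B : Set H) : g • A ∩ B = g • (A ∩ g⁻¹ • B) := by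
  rw [Set.smul_set_inter, smul_inv_smul]

instance : ContinuousConstSMul G (ClosedSubsets G) where
  continuous_const_smul g := by
    refine continuous_generateFrom_iff.2 ?_
    rintro U (⟨K, hK, rfl⟩ | ⟨V, hV, rfl⟩)
    · refine TopologicalSpace.isOpen_generateFrom_of_mem (Or.inl ⟨g⁻¹ • K, hK.smul _, ?_⟩)
      ext A
      simp only [Set.mem_preimage, Set.mem_ofPred_eq, carrier_smul, smul_inter_eq,
        Set.smul_set_eq_empty]
    · refine TopologicalSpace.isOpen_generateFrom_of_mem (Or.inr ⟨g⁻¹ • V, hV.smul _, ?_⟩)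
      ext A
      simp only [Set.mem_preimage, Set.mem_ofPred_eq, carrier_smul, smul_inter_eq,
        Set.smul_set_nonempty]

end ClosedSubsets

section Hull

variable {G : Type*} [Group G] [TopologicalSpace G] [IsTopologicalGroup G]

/-- The hull of a closed subset `P` of `G`: the closure of its `G`-orbit in the Chabauty-Fell
space. As a type it carries the subspace topology and the corresponding Borel structure. -/
def hull (P : ClosedSubsets G) : Set (ClosedSubsets G) := closure (MulAction.orbit G P)

theorem smul_mem_hull (P : ClosedSubsets G) (g : G) {Q : ClosedSubsets G} (hQ : Q ∈ hull P) :
    g • Q ∈ hull P := by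
  refine map_mem_closure (continuous_const_smul g) hQ ?_
  rintro _ ⟨h, rfl⟩
  exact ⟨g * h, mul_smul g h P⟩

/-- The action of `G` on the hull by left translation. -/
instance (P : ClosedSubsets G) : MulAction G (hull P) where
  smul g Q := ⟨g • Q.1, smul_mem_hull P g Q.2⟩
  one_smul Q := Subtype.ext (one_smul G Q.1)
  mul_smul g h Q := Subtype.ext (mul_smul g h Q.1)

/-- A strong approximate lattice is a uniformly discrete approximate subgroup whose hull admits a
`G`-invariant Borel probability measure which gives mass zero to the point `∅`. -/
def IsStrongApproximateLattice (A : Set G) : Prop :=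
  IsApproxSubgroup A ∧ ∃ h : IsUniformlyDiscrete A,
    ∃ ν : Measure (hull (⟨A, h.isClosed⟩ : ClosedSubsets G)),
      IsProbabilityMeasure ν ∧ SMulInvariantMeasure G _ ν ∧ ν {Q | Q.1.carrier = ∅} = 0

end Hull

/-- `G` is generated as a group by a compact subset. -/
def IsCompactlyGeneratedGroup (G : Type*) [Group G] [TopologicalSpace G] : Prop :=
  ∃ K : Set G, IsCompact K ∧ Subgroup.closure K = ⊤

/-- `G` is unimodular if every left Haar measure is right-invariant. -/
def IsUnimodular (G : Type*) [Group G] [TopologicalSpace G] [MeasurableSpace G] : Prop :=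
  ∀ m : Measure G, m.IsHaarMeasure → m.IsMulRightInvariant

end ApproxLattice

/-! Write `Δ` for the modular character; unimodularity is `Δ = 1`. Every power of an approximate
subgroup `A` meeting compact sets in finite sets does so too.

Uniform case: if `A * D = G` with `D` compact, then also `A * (D * g⁻¹) = G`. Any `D'` with `A * D'
= G` has Haar measure bounded below independently of `D'` (`measure_le_encard_mul_of_mul_eq_univ`),
while `D * g⁻¹` has measure `Δ g` times that of `D`. So `Δ` is bounded away from `0`, and a
homomorphism to the positive reals with this property is trivial.

Strong case: a `ν`-random element `P` of the hull satisfies `P⁻¹ * P ⊆ A ^ 2`, so its expected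
number of points in a set is a Haar measure (`isHaarMeasure_intensity`). Counting points of `P` in
`K * g⁻¹` for `g ∈ A` bounds `Δ` on `A`, hence on `A ^ 2`, so `M = sup Δ` over `P` is almost surely
positive and finite. Translation by `h` multiplies `M` by `Δ h` without changing its law; if `Δ g >
1` for some `g`, this forces `P = ∅` almost surely, a contradiction. -/

namespace ApproxLattice

/-! ### Locally finite sets and powers of approximate subgroups -/

section LocallyFinite

/-- A set all of whose intersections with compact sets are finite. -/
def IsLocallyFiniteSet {X : Type*} [TopologicalSpace X] (S : Set X) : Prop :=
  ∀ K : Set X, IsCompact K → (S ∩ K).Finite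

theorem IsLocallyFiniteSet.mono {X : Type*} [TopologicalSpace X] {S T : Set X}
    (hT : IsLocallyFiniteSet T) (h : S ⊆ T) : IsLocallyFiniteSet S :=
  fun K hK => (hT K hK).subset (Set.inter_subset_inter_left K h)

theorem IsLocallyFiniteSet.isClosed {X : Type*} [TopologicalSpace X] [LocallyCompactSpace X]
    [T2Space X] {S : Set X} (hS : IsLocallyFiniteSet S) : IsClosed S := by
  rw [← isOpen_compl_iff, isOpen_iff_mem_nhds]
  intro x hx
  obtain ⟨K, hK, hxK⟩ := exists_compact_mem_nhds x
  have h : (S ∩ K)ᶜ ∈ 𝓝 x := (hS K hK).isClosed.isOpen_compl.mem_nhds fun h => hx h.1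
  filter_upwards [h, hxK] with y hy hyK hyS
  exact hy ⟨hyS, hyK⟩

theorem IsLocallyFiniteSet.countable {X : Type*} [TopologicalSpace X] [SigmaCompactSpace X]
    {S : Set X} (hS : IsLocallyFiniteSet S) : S.Countable := by
  have : S = ⋃ n, S ∩ compactCovering X n := by
    rw [← Set.inter_iUnion, iUnion_compactCovering, Set.inter_univ]
  rw [this]
  exact Set.countable_iUnion fun n => (hS _ (isCompact_compactCovering X n)).countable

variable {G : Type*} [Group G] [TopologicalSpace G]

theorem IsLocallyFiniteSet.finset_mul [IsTopologicalGroup G] {S : Set G}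
    (hS : IsLocallyFiniteSet S) (F : Finset G) : IsLocallyFiniteSet ((F : Set G) * S) := by
  intro K hK
  refine (F.finite_toSet.biUnion fun f _ => (hS (f⁻¹ • K) (hK.smul _)).smul_set (a := f)).subset ?_
  rintro _ ⟨⟨f, hf, s, hs, rfl⟩, hfs⟩
  exact Set.mem_biUnion hf ⟨s, ⟨hs, f * s, hfs, by simp⟩, by simp⟩

theorem IsUniformlyDiscrete.isLocallyFiniteSet {A : Set G} (h : IsUniformlyDiscrete A) :
    IsLocallyFiniteSet A := by
  obtain ⟨d, hd, r, hr, -, hA⟩ := h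
  have hind := hd.induces
  subst hind
  intro K hK
  have hs : ∀ B ⊆ A, IsClosed B := fun B hB =>
    Metric.isClosed_of_pairwise_le_dist hr fun x hx y hy hxy => hA x (hB hx) y (hB hy) hxy
  have hc : IsCompact (A ∩ K) := hK.inter_left (hs A subset_rfl)
  refine hc.finite ?_
  rw [isDiscrete_iff_discreteTopology, discreteTopology_subtype_iff']
  intro x hx
  refine ⟨Metric.ball x r, Metric.isOpen_ball, Set.eq_singleton_iff_unique_mem.2
    ⟨⟨Metric.mem_ball_self hr, hx⟩, fun y hy => ?_⟩⟩
  by_contra hne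
  exact absurd (hA y hy.2.1 x hx.1 hne) (not_le.2 hy.1)

/-- From `A ^ 2 ⊆ F * A`, each further power lies in finitely many translates of the previous one.
-/
theorem IsApproximateSubgroup.isLocallyFiniteSet_pow [IsTopologicalGroup G] {k : ℝ} {A : Set G}
    (hA : IsApproximateSubgroup k A) (hl : IsLocallyFiniteSet A) (n : ℕ) :
    IsLocallyFiniteSet (A ^ (n + 1)) := by
  obtain ⟨F, -, hF⟩ := hA.sq_covBySMul
  induction n with
  | zero => simpa using hl
  | succ n ih =>
    refine (ih.finset_mul F).mono ?_
    calc A ^ (n + 1 + 1) = A ^ 2 * A ^ n := by rw [← pow_add, add_comm 2 n]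
      _ ⊆ (F : Set G) * A * A ^ n := Set.mul_subset_mul_right hF
      _ = (F : Set G) * A ^ (n + 1) := by rw [mul_assoc, pow_succ']

end LocallyFinite

/-! ### Lower bound for the measure of covering sets -/

/-- Fixing one base point `y` of `T` embeds `T` in `R` by `f y`. With `f` a difference map, this
bounds point counts using differences alone, wherever `T` lies. -/
theorem encard_le_of_injOn_translate {G : Type*} {T R : Set G} (f : G → G → G)
    (hf : ∀ y, Function.Injective (f y)) (h : ∀ y ∈ T, ∀ z ∈ T, f y z ∈ R) :
    T.encard ≤ R.encard := by
  rcases T.eq_empty_or_nonempty with rfl | ⟨y, hy⟩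
  · simp
  · exact Set.encard_le_encard_of_injOn (f := f y) (fun z hz => h y hy z hz) (hf y).injOn

/-- If the left translates of `D` by `A` cover the group, the measure of `D` is bounded below in
terms of the number of points of `A⁻¹ * A` in a compact set. -/
theorem measure_le_encard_mul_of_mul_eq_univ {G : Type*} [Group G] [TopologicalSpace G]
    [IsTopologicalGroup G] [MeasurableSpace G] [BorelSpace G] (m : Measure G)
    [m.IsMulLeftInvariant]
    {A B D : Set G} (hA : A.Countable) (hB : MeasurableSet B)
    (h : A * D = Set.univ) : m B ≤ ((A * A⁻¹) ∩ (B * B⁻¹)).encard * m D := by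
  have := hA.to_subtype
  calc m B ≤ m (⋃ a : A, B ∩ (a : G) • D) := by
        refine measure_mono fun b hb => ?_
        obtain ⟨a, ha, d, hd, rfl⟩ := h.symm ▸ Set.mem_univ b
        exact Set.mem_iUnion.2 ⟨⟨a, ha⟩, hb, d, hd, rfl⟩
    _ ≤ ∑' a : A, m (B ∩ (a : G) • D) := measure_iUnion_le _
    -- Translating by `a⁻¹` moves each piece into `D`; the sum then integrates over `D` the number
    -- of `a ∈ A` with `a * d ∈ B`.
    _ = ∑' a : A, ∫⁻ d in D, ((a : G)⁻¹ • B).indicator 1 d ∂m := by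
        congr 1 with a
        rw [lintegral_indicator_one (hB.const_smul _), Measure.restrict_apply (hB.const_smul _),
          ← measure_smul m (a : G)⁻¹ (B ∩ (a : G) • D), Set.smul_set_inter, inv_smul_smul]
    _ = ∫⁻ d in D, ∑' a : A, ((a : G)⁻¹ • B).indicator 1 d ∂m :=
        (lintegral_tsum fun a => (measurable_one.indicator (hB.const_smul _)).aemeasurable).symm
    _ ≤ ∫⁻ _ in D, (((A * A⁻¹) ∩ (B * B⁻¹)).encard : ENNReal) ∂m := by
        refine lintegral_mono fun d => ?_
        have : ∑' a : A, ((a : G)⁻¹ • B).indicator (1 : G → ENNReal) d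
            = ({a ∈ A | a * d ∈ B}.encard : ENNReal) := by
          rw [← ENNReal.tsum_set_one, tsum_subtype A fun a =>
            (a⁻¹ • B).indicator (1 : G → ENNReal) d, tsum_subtype {a ∈ A | a * d ∈ B} fun _ => 1]
          congr 1 with a
          by_cases ha : a ∈ A <;> by_cases hb : a * d ∈ B <;>
            simp [Set.indicator, ha, hb, Set.mem_inv_smul_set_iff]
        rw [this]
        refine ENat.toENNReal_le.2 (encard_le_of_injOn_translate (fun y z => z * y⁻¹)
          (fun y => mul_left_injective _) ?_)
        rintro y ⟨hy, hyd⟩ z ⟨hz, hzd⟩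
        exact ⟨Set.mul_mem_mul hz (Set.inv_mem_inv.2 hy), z * d, hzd, (y * d)⁻¹,
          Set.inv_mem_inv.2 hyd, by group⟩
    _ = ((A * A⁻¹) ∩ (B * B⁻¹)).encard * m D := by
        rw [setLIntegral_const]

/-! ### The modular character and the uniform case -/

section Modular

variable {G : Type*} [Group G] [TopologicalSpace G] [IsTopologicalGroup G]
  [LocallyCompactSpace G]

open Measure

theorem modularCharacterFun_pow (g : G) (n : ℕ) :
    modularCharacterFun (g ^ n) = modularCharacterFun g ^ n :=
  map_pow modularCharacter g n

theorem modularCharacterFun_mul_inv (g : G) :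
    modularCharacterFun g * modularCharacterFun g⁻¹ = 1 := by
  rw [← modularCharacterFun_map_mul, mul_inv_cancel, modularCharacterFun_map_one]

theorem modularCharacterFun_eq_one_of_forall_not_one_lt
    (h : ∀ g : G, ¬ 1 < modularCharacterFun g) (g : G) : modularCharacterFun g = 1 := by
  refine le_antisymm (not_lt.1 (h g)) ?_
  rw [← modularCharacterFun_mul_inv g]
  exact mul_le_of_le_one_right' (not_lt.1 (h _))

/-- If the character exceeded `1` at `g`, its values at the powers of `g⁻¹` would tend to `0`. -/
theorem modularCharacterFun_eq_one_of_bddBelow {c : NNReal} (hc : 0 < c)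
    (h : ∀ g : G, c ≤ modularCharacterFun g) (g : G) : modularCharacterFun g = 1 := by
  refine modularCharacterFun_eq_one_of_forall_not_one_lt (fun g hg => ?_) g
  have hlt : modularCharacterFun g⁻¹ < 1 := by
    by_contra hle
    exact absurd (modularCharacterFun_mul_inv g) (one_lt_mul_of_lt_of_le hg (not_lt.1 hle)).ne'
  obtain ⟨n, hn⟩ := exists_pow_lt_of_lt_one hc hlt
  exact absurd (h (g⁻¹ ^ n)) (not_le.2 (by rwa [modularCharacterFun_pow]))

variable [SecondCountableTopology G] [MeasurableSpace G] [BorelSpace G]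

theorem map_mul_right_eq_modularCharacterFun_smul (m : Measure G) [m.IsHaarMeasure] (g : G) :
    map (· * g) m = modularCharacterFun g • m := by
  rw [modularCharacterFun_eq_haarScalarFactor m]
  exact isMulLeftInvariant_eq_smul _ m

theorem measure_preimage_mul_right_eq (m : Measure G) [m.IsHaarMeasure] (g : G) {s : Set G}
    (hs : MeasurableSet s) : m ((· * g) ⁻¹' s) = modularCharacterFun g * m s := by
  rw [← map_apply (measurable_mul_const g) hs, map_mul_right_eq_modularCharacterFun_smul]
  rfl

theorem isUnimodular_of_modularCharacterFun_eq_one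
    (h : ∀ g : G, modularCharacterFun g = 1) : IsUnimodular G := by
  intro m hm
  exact ⟨fun g => by rw [map_mul_right_eq_modularCharacterFun_smul m g, h, one_smul]⟩

/-- The character at `g` is the Haar measure of a section of an open subset of `G × G`, divided by a
constant. -/
theorem measurable_modularCharacterFun :
    Measurable fun g : G => (modularCharacterFun g : ENNReal) := by
  obtain ⟨K, hK, hKx⟩ := exists_compact_mem_nhds (1 : G)
  have h0 : (haar : Measure G) (interior K) ≠ 0 :=
    (isOpen_interior.measure_pos _ ⟨1, mem_interior_iff_mem_nhds.2 hKx⟩).ne'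
  have htop : (haar : Measure G) (interior K) ≠ ⊤ :=
    ((measure_mono interior_subset).trans_lt hK.measure_lt_top).ne
  have hm : MeasurableSet {p : G × G | p.2 * p.1 ∈ interior K} :=
    (isOpen_interior.preimage (by fun_prop)).measurableSet
  have : (fun g : G => (modularCharacterFun g : ENNReal)) = fun g =>
      (haar : Measure G) (Prod.mk g ⁻¹' {p : G × G | p.2 * p.1 ∈ interior K}) /
        (haar : Measure G) (interior K) := by
    ext g
    rw [ENNReal.eq_div_iff h0 htop, mul_comm]
    exact (measure_preimage_mul_right_eq _ g isOpen_interior.measurableSet).symm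
  rw [this]
  exact (measurable_measure_prodMk_left hm).div_const _

theorem isUnimodular_of_isUniformApproximateLattice [T2Space G] {A : Set G}
    (hA : IsUniformApproximateLattice A) : IsUnimodular G := by
  obtain ⟨⟨k, hk⟩, d, hd, hr, R, hR, -, hcov⟩ := hA
  have hl : IsLocallyFiniteSet A := IsUniformlyDiscrete.isLocallyFiniteSet ⟨d, hd, hr⟩
  obtain ⟨D, hDc, hD⟩ : ∃ D : Set G, IsCompact D ∧ A * D = Set.univ := by
    have hinv := hd.left_invariant
    have hp := hd.proper
    have hind := hd.induces
    subst hind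
    -- By left invariance, `g` within `R` of `x` means that `x⁻¹ * g` is within `R` of `1`.
    refine ⟨Metric.closedBall 1 R, isCompact_closedBall _ _, Set.eq_univ_of_forall fun g => ?_⟩
    obtain ⟨x, hx, hgx⟩ := Set.mem_iUnion₂.1 (hcov.symm ▸ Set.mem_univ g)
    refine ⟨x, hx, x⁻¹ * g, ?_, by simp⟩
    have := hinv x⁻¹ g x
    rw [inv_mul_cancel] at this
    exact (this.trans_lt hgx).le
  obtain ⟨B, hB, hBx⟩ := exists_compact_mem_nhds (1 : G)
  have hfin : ((A * A⁻¹) ∩ (B * B⁻¹)).Finite := by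
    rw [hk.inv_eq_self, ← sq]
    exact IsApproximateSubgroup.isLocallyFiniteSet_pow hk hl 1 _ (hB.mul hB.inv)
  set N : ENNReal := ENat.toENNReal ((A * A⁻¹) ∩ (B * B⁻¹)).encard with hN
  have hNtop : N ≠ ⊤ := by simpa [hN] using hfin
  let m : Measure G := haar
  have hB0 : m B ≠ 0 := (measure_pos_of_mem_nhds m hBx).ne'
  have key : ∀ g : G, m B ≤ N * (modularCharacterFun g * m D) := by
    intro g
    rw [← measure_preimage_mul_right_eq m g hDc.measurableSet]
    refine measure_le_encard_mul_of_mul_eq_univ m hl.countable hB.measurableSet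
      (Set.eq_univ_of_forall fun x => ?_)
    obtain ⟨a, ha, y, hy, hxy⟩ := hD.symm ▸ Set.mem_univ (x * g)
    exact ⟨a, ha, y * g⁻¹, by simpa using hy, by simpa [← mul_assoc, mul_inv_eq_iff_eq_mul] using hxy⟩
  have hfinite : N * m D ≠ ⊤ := ENNReal.mul_ne_top hNtop hDc.measure_lt_top.ne
  have h0 : N * m D ≠ 0 := by
    intro h0
    have := key 1
    rw [modularCharacterFun_map_one, ENNReal.coe_one, one_mul, h0] at this
    exact hB0 (le_antisymm this bot_le)
  have hc : m B / (N * m D) ≠ ⊤ := (ENNReal.div_lt_top hB.measure_lt_top.ne h0).ne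
  refine isUnimodular_of_modularCharacterFun_eq_one
    (modularCharacterFun_eq_one_of_bddBelow
      (ENNReal.toNNReal_pos (ENNReal.div_pos hB0 hfinite).ne' hc) fun g => ?_)
  rw [← ENNReal.coe_le_coe, ENNReal.coe_toNNReal hc]
  refine ENNReal.div_le_of_le_mul ?_
  calc m B ≤ _ := key g
    _ = _ := by ring

end Modular

end ApproxLattice

namespace ApproxLattice

/-! ### Measurability of counting points in a random set -/

section RandomSets

variable {X : Type*} [MeasurableSpace X]

/-- Finitely many points can be separated by disjoint basic open sets, so the event of having at
least `n` points in `V` is a countable union of finite intersections of hitting events. -/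
theorem natCast_le_encard_iff_exists_basis {G : Type*} [TopologicalSpace G] [T2Space G]
    [SecondCountableTopology G] {T V : Set G} (hV : IsOpen V) (n : ℕ) :
    (n : ℕ∞) ≤ (T ∩ V).encard ↔ ∃ f : Fin n → TopologicalSpace.countableBasis G,
      (Pairwise (Function.onFun Disjoint fun i => (f i : Set G)) ∧ ∀ i, (f i : Set G) ⊆ V) ∧
        ∀ i, (T ∩ f i).Nonempty := by
  constructor
  · intro h
    obtain ⟨t, ht, htn⟩ := Set.exists_subset_encard_eq h
    have htf : t.Finite := Set.finite_of_encard_eq_coe htn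
    obtain ⟨U, hU, hdis⟩ := htf.t2_separation
    have hb : ∀ x : t, ∃ W ∈ TopologicalSpace.countableBasis G, (x : G) ∈ W ∧ W ⊆ U x ∩ V :=
      fun x => (TopologicalSpace.isBasis_countableBasis G).exists_subset_of_mem_open
        ⟨(hU x).1, (ht x.2).2⟩ ((hU x).2.inter hV)
    choose W hWb hxW hWU using hb
    have := htf.fintype
    have hcard : Fintype.card t = n := by
      rw [← Nat.card_eq_fintype_card, Nat.card_coe_set_eq, Set.ncard, htn]; rfl
    let e := (Fintype.equivFinOfCardEq hcard).symm
    refine ⟨fun i => ⟨W (e i), hWb _⟩, ⟨fun i j hij => ?_, fun i => ?_⟩, fun i => ?_⟩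
    · refine (hdis (e i).2 (e j).2 fun h => hij (e.injective (Subtype.ext h))).mono ?_ ?_
      · exact (hWU _).trans Set.inter_subset_left
      · exact (hWU _).trans Set.inter_subset_left
    · exact (hWU _).trans Set.inter_subset_right
    · exact ⟨e i, (ht (e i).2).1, hxW _⟩
  · rintro ⟨f, ⟨hdis, hfV⟩, hne⟩
    choose p hp using hne
    have hinj : Function.Injective p := fun i j hij => by
      by_contra hne
      exact Set.disjoint_left.1 (hdis hne) (hp i).2 (hij ▸ (hp j).2)
    calc (n : ℕ∞) = (Set.range p).encard := by
          rw [← Set.image_univ, hinj.encard_image]; simp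
      _ ≤ _ := Set.encard_le_encard (by rintro _ ⟨i, rfl⟩; exact ⟨(hp i).1, hfV i (hp i).2⟩)

theorem measurable_encard_inter_of_isOpen {G : Type*} [TopologicalSpace G] [T2Space G]
    [SecondCountableTopology G] {P : X → Set G}
    (hP : ∀ V, IsOpen V → MeasurableSet {x | (P x ∩ V).Nonempty}) {V : Set G} (hV : IsOpen V) :
    Measurable fun x => ((P x ∩ V).encard : ENNReal) := by
  have hn : ∀ n : ℕ, MeasurableSet {x | (n : ℕ∞) ≤ (P x ∩ V).encard} := by
    intro n
    simp only [natCast_le_encard_iff_exists_basis hV, Set.ofPred_exists]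
    have := TopologicalSpace.countable_countableBasis G
    refine MeasurableSet.iUnion fun f => ?_
    rw [Set.ofPred_and, Set.ofPred_forall]
    exact (MeasurableSet.const _).inter (MeasurableSet.iInter fun i =>
      hP _ (TopologicalSpace.isOpen_of_mem_countableBasis (f i).2))
  refine measurable_of_Ioi fun a => ?_
  have : (fun x => ((P x ∩ V).encard : ENNReal)) ⁻¹' Set.Ioi a =
      ⋃ n : ℕ, ⋃ _ : a < n, {x | (n : ℕ∞) ≤ (P x ∩ V).encard} := by
    ext x
    simp only [Set.mem_preimage, Set.mem_Ioi, Set.mem_iUnion, exists_prop, Set.mem_ofPred_eq]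
    constructor
    · intro h
      obtain ⟨n, hn⟩ | htop := em (∃ n : ℕ, (P x ∩ V).encard = n)
      · exact ⟨n, by simpa [hn] using h, hn.ge⟩
      · have htop : (P x ∩ V).encard = ⊤ := by
          by_contra hne
          exact htop ⟨_, (ENat.natCast_toNat hne).symm⟩
        obtain ⟨n, hn⟩ := ENNReal.exists_nat_gt (h.trans_le le_top).ne
        exact ⟨n, hn, by simp [htop]⟩
    · rintro ⟨n, han, hn⟩
      exact han.trans_le (by simpa using ENat.toENNReal_le.2 hn)
  rw [this]
  exact MeasurableSet.iUnion fun n => MeasurableSet.iUnion fun _ => hn n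

/-- Counting the points of a random locally finite set is measurable. -/
theorem measurable_count_restrict {G : Type*} [TopologicalSpace G] [T2Space G]
    [SecondCountableTopology G] [LocallyCompactSpace G] [MeasurableSpace G] [BorelSpace G]
    {P : X → Set G} (hP : ∀ V, IsOpen V → MeasurableSet {x | (P x ∩ V).Nonempty})
    (hl : ∀ x, IsLocallyFiniteSet (P x)) :
    Measurable fun x => (Measure.count : Measure G).restrict (P x) := by
  let E : CompactExhaustion G := CompactExhaustion.choice G
  let C : ℕ → Set G := fun n => interior (E n)
  have hC : ∀ n, IsOpen (C n) := fun n => isOpen_interior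
  have hCmono : Monotone C := fun m n h => interior_mono (E.subset h)
  have hCU : ⋃ n, C n = Set.univ := Set.eq_univ_of_forall fun x => by
    obtain ⟨n, hn⟩ := E.exists_mem x
    exact Set.mem_iUnion.2 ⟨n + 1, E.subset_interior_succ n hn⟩
  -- Truncation to relatively compact open sets makes the counting measures finite, so that
  -- measurability on the π-system of open sets extends to all Borel sets.
  let κ : ℕ → X → Measure G := fun n x => (Measure.count.restrict (P x)).restrict (C n)
  have hfin : ∀ n x, IsFiniteMeasure (κ n x) := fun n x => by
    refine ⟨?_⟩
    rw [Measure.restrict_apply_univ, Measure.restrict_apply (hC n).measurableSet]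
    have : (C n ∩ P x).Finite := by
      rw [Set.inter_comm]
      exact ((hl x) _ (E.isCompact n)).subset (Set.inter_subset_inter_right _ interior_subset)
    exact Measure.count_apply_lt_top.2 this
  have hκo : ∀ n, ∀ V : Set G, IsOpen V → Measurable fun x => κ n x V := fun n V hV => by
    convert measurable_encard_inter_of_isOpen hP (hV.inter (hC n)) using 2 with x
    rw [Measure.restrict_apply hV.measurableSet, Measure.restrict_apply
      (hV.inter (hC n)).measurableSet, Measure.count_apply, Set.inter_comm]
    exact (hV.inter (hC n)).measurableSet.inter (hl x).isClosed.measurableSet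
  have hκ : ∀ n, Measurable (κ n) := fun n =>
    Measurable.measure_of_isPiSystem (BorelSpace.measurable_eq (α := G)) isPiSystem_isOpen
      (fun V hV => hκo n V hV) (hκo n _ isOpen_univ)
  refine Measure.measurable_of_measurable_coe _ fun s hs => ?_
  have : (fun x => (Measure.count : Measure G).restrict (P x) s) = fun x => ⨆ n, κ n x s := by
    ext x
    simp only [κ, Measure.restrict_apply hs]
    rw [← Monotone.measure_iUnion, ← Set.inter_iUnion, hCU, Set.inter_univ,
      Measure.restrict_apply hs]
    exact fun m n h => Set.inter_subset_inter_right _ (hCmono h)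
  rw [this]
  exact Measurable.iSup fun n => (Measure.measurable_coe hs).comp (hκ n)

end RandomSets

end ApproxLattice

namespace ApproxLattice

/-! ### Intensity measures and invariant random sets -/

section Intensity

theorem isLocallyFiniteSet_of_inv_mul_mem {G : Type*} [Group G] [TopologicalSpace G]
    [IsTopologicalGroup G] {T S : Set G} (hS : IsLocallyFiniteSet S)
    (h : ∀ y ∈ T, ∀ z ∈ T, y⁻¹ * z ∈ S) : IsLocallyFiniteSet T := by
  rcases T.eq_empty_or_nonempty with rfl | ⟨y, hy⟩
  · exact fun K _ => by simp
  · exact (hS.finset_mul {y}).mono fun z hz => ⟨y, by simp, y⁻¹ * z, h y hy z hz, by simp⟩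

variable {G : Type*} [TopologicalSpace G] [MeasurableSpace G] {X : Type*} [MeasurableSpace X]

/-- The intensity measure of a random subset `P`: the expected number of points of `P` in a set. -/
noncomputable def intensity (ν : Measure X) (P : X → Set G) : Measure G :=
  ν.bind fun x => (Measure.count : Measure G).restrict (P x)

variable {ν : Measure X} {P : X → Set G}
  [T2Space G] [SecondCountableTopology G] [LocallyCompactSpace G] [BorelSpace G]

theorem measurable_encard_inter (hP : ∀ V, IsOpen V → MeasurableSet {x | (P x ∩ V).Nonempty})
    (hl : ∀ x, IsLocallyFiniteSet (P x)) {s : Set G} (hs : MeasurableSet s) :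
    Measurable fun x => ((P x ∩ s).encard : ENNReal) := by
  convert (Measure.measurable_coe hs).comp (measurable_count_restrict hP hl) using 2 with x
  rw [Function.comp_apply, Measure.restrict_apply hs,
    Measure.count_apply (hs.inter (hl x).isClosed.measurableSet), Set.inter_comm]

theorem measurableSet_inter_nonempty
    (hP : ∀ V, IsOpen V → MeasurableSet {x | (P x ∩ V).Nonempty})
    (hl : ∀ x, IsLocallyFiniteSet (P x)) {s : Set G} (hs : MeasurableSet s) :
    MeasurableSet {x | (P x ∩ s).Nonempty} := by
  convert (measurable_encard_inter hP hl hs (measurableSet_singleton 0)).compl using 1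
  ext x
  simp [Set.nonempty_iff_ne_empty]

theorem intensity_apply (hP : ∀ V, IsOpen V → MeasurableSet {x | (P x ∩ V).Nonempty})
    (hl : ∀ x, IsLocallyFiniteSet (P x)) {s : Set G} (hs : MeasurableSet s) :
    intensity ν P s = ∫⁻ x, ((P x ∩ s).encard : ENNReal) ∂ν := by
  rw [intensity, Measure.bind_apply hs (measurable_count_restrict hP hl).aemeasurable]
  refine lintegral_congr fun x => ?_
  rw [Measure.restrict_apply hs, Measure.count_apply (hs.inter (hl x).isClosed.measurableSet),
    Set.inter_comm]

theorem intensity_apply_le [IsProbabilityMeasure ν]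
    (hP : ∀ V, IsOpen V → MeasurableSet {x | (P x ∩ V).Nonempty})
    (hl : ∀ x, IsLocallyFiniteSet (P x)) {s : Set G} (hs : MeasurableSet s) {N : ℕ∞}
    (h : ∀ x, (P x ∩ s).encard ≤ N) : intensity ν P s ≤ N := by
  rw [intensity_apply hP hl hs]
  calc ∫⁻ x, ((P x ∩ s).encard : ENNReal) ∂ν ≤ ∫⁻ _, (N : ENNReal) ∂ν :=
        lintegral_mono fun x => ENat.toENNReal_le.2 (h x)
    _ = N := by simp

variable [Group G] [IsTopologicalGroup G] [MulAction G X] [MeasurableConstSMul G X]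

/-- Invariance of `ν` and equivariance of `P` give left invariance; the bound by `S ∩ (K⁻¹ * K)`
gives finiteness on compacts. If an open set had intensity zero, `P` would almost surely miss
countably many translates covering `G`, hence be empty. -/
theorem isHaarMeasure_intensity [IsProbabilityMeasure ν] [SMulInvariantMeasure G X ν]
    (hP : ∀ V, IsOpen V → MeasurableSet {x | (P x ∩ V).Nonempty})
    (hequiv : ∀ (g : G) (x : X), P (g • x) = g • P x) (hempty : ν {x | P x = ∅} = 0)
    {S : Set G} (hS : IsLocallyFiniteSet S) (hPS : ∀ x, ∀ y ∈ P x, ∀ z ∈ P x, y⁻¹ * z ∈ S) :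
    (intensity ν P).IsHaarMeasure := by
  have hl : ∀ x, IsLocallyFiniteSet (P x) := fun x => isLocallyFiniteSet_of_inv_mul_mem hS (hPS x)
  have hopen : ∀ V : Set G, IsOpen V → V.Nonempty → intensity ν P V ≠ 0 := by
    intro V hV hVne h0
    rw [intensity_apply hP hl hV.measurableSet,
      lintegral_eq_zero_iff (measurable_encard_inter hP hl hV.measurableSet)] at h0
    have hnull : ν {x | (P x ∩ V).Nonempty} = 0 := by
      refine measure_mono_null ?_ (ae_iff.1 h0)
      intro x hx
      simpa [Set.nonempty_iff_ne_empty] using hx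
    have hnull' : ∀ g : G, ν {x | (P x ∩ g • V).Nonempty} = 0 := by
      intro g
      refine measure_mono_null ?_ (measure_preimage_smul_null hnull g⁻¹)
      rintro x ⟨_, hx, v, hv, rfl⟩
      exact ⟨v, by rw [hequiv]; exact ⟨_, hx, by simp⟩, hv⟩
    obtain ⟨v, hv⟩ := hVne
    obtain ⟨c, hc, hcU⟩ := TopologicalSpace.countable_cover_nhds
      (f := fun g : G => (g * v⁻¹) • V) fun g => (hV.smul _).mem_nhds ⟨v, hv, by simp⟩
    have huniv : (Set.univ : Set X) ⊆
        {x | P x = ∅} ∪ ⋃ g ∈ c, {x | (P x ∩ (g * v⁻¹) • V).Nonempty} := by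
      intro x _
      rcases (P x).eq_empty_or_nonempty with hx | ⟨y, hy⟩
      · exact Or.inl hx
      · obtain ⟨g, hg, hyg⟩ := Set.mem_iUnion₂.1 (hcU.symm ▸ Set.mem_univ y)
        exact Or.inr (Set.mem_biUnion hg ⟨y, hy, hyg⟩)
    have := measure_mono_null huniv (measure_union_null hempty
      ((measure_biUnion_null_iff hc).2 fun g _ => hnull' _))
    simp at this
  exact
    { lt_top_of_isCompact := fun K hK => by
        refine (intensity_apply_le hP hl hK.measurableSet (N := (S ∩ (K⁻¹ * K)).encard)
          fun x => ?_).trans_lt ?_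
        · refine encard_le_of_injOn_translate (fun y z => y⁻¹ * z)
            (fun y => mul_right_injective _) ?_
          rintro y ⟨hy, hyK⟩ z ⟨hz, hzK⟩
          exact ⟨hPS x y hy z hz, Set.mul_mem_mul (Set.inv_mem_inv.2 hyK) hzK⟩
        · simpa using hS _ (hK.inv.mul hK)
      map_mul_left_eq_self := fun g => by
        ext s hs
        have hgs := measurable_const_mul g hs
        rw [Measure.map_apply (measurable_const_mul g) hs, intensity_apply hP hl hgs,
          intensity_apply hP hl hs, ← (measurePreserving_smul g ν).lintegral_comp
            (measurable_encard_inter hP hl hs)]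
        refine lintegral_congr fun x => ?_
        rw [hequiv, ← (mul_right_injective g).encard_image (P x ∩ _), Set.image_inter_preimage]
        rfl
      open_pos := hopen }

/-- The intensity of `K * g⁻¹` is `Δ g` times that of `K`. For `y, z ∈ P ∩ K * g⁻¹` and `g ∈ A`, the
element `g⁻¹ * (y⁻¹ * z) * g` lies in the finite set `A ^ 4 ∩ (K⁻¹ * K)`, which does not depend on
`g`. -/
theorem bddAbove_modularCharacterFun [IsProbabilityMeasure ν] [SMulInvariantMeasure G X ν]
    (hP : ∀ V, IsOpen V → MeasurableSet {x | (P x ∩ V).Nonempty})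
    (hequiv : ∀ (g : G) (x : X), P (g • x) = g • P x) (hempty : ν {x | P x = ∅} = 0)
    {k : ℝ} {A : Set G} (hA : IsApproximateSubgroup k A) (hl : IsLocallyFiniteSet A)
    (hPA : ∀ x, ∀ y ∈ P x, ∀ z ∈ P x, y⁻¹ * z ∈ A ^ 2) :
    ∃ c : NNReal, ∀ g ∈ A, Measure.modularCharacterFun g ≤ c := by
  have hA2 := IsApproximateSubgroup.isLocallyFiniteSet_pow hA hl 1
  have := isHaarMeasure_intensity hP hequiv hempty hA2 hPA
  obtain ⟨K, hK, hKx⟩ := exists_compact_mem_nhds (1 : G)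
  have hK0 : intensity ν P K ≠ 0 := (Measure.measure_pos_of_mem_nhds _ hKx).ne'
  set N : ENNReal := ENat.toENNReal (A ^ 4 ∩ (K⁻¹ * K)).encard with hN
  have hNtop : N ≠ ⊤ := by
    simpa [hN] using IsApproximateSubgroup.isLocallyFiniteSet_pow hA hl 3 _ (hK.inv.mul hK)
  have hc : N / intensity ν P K ≠ ⊤ := (ENNReal.div_lt_top hNtop hK0).ne
  refine ⟨(N / intensity ν P K).toNNReal, fun g hg => ?_⟩
  rw [← ENNReal.coe_le_coe, ENNReal.coe_toNNReal hc,
    ENNReal.le_div_iff_mul_le (Or.inl hK0) (Or.inl hK.measure_lt_top.ne),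
    ← measure_preimage_mul_right_eq _ g hK.measurableSet]
  refine intensity_apply_le hP (fun x => isLocallyFiniteSet_of_inv_mul_mem hA2 (hPA x))
    (measurable_mul_const g hK.measurableSet) fun x => ?_
  refine encard_le_of_injOn_translate (fun y z => g⁻¹ * (y⁻¹ * z) * g)
    (fun y a b hab => by simpa using hab) ?_
  rintro y ⟨hy, hyK⟩ z ⟨hz, hzK⟩
  refine ⟨?_, (y * g)⁻¹, Set.inv_mem_inv.2 hyK, z * g, hzK, by group⟩
  have hg' : g⁻¹ ∈ A := by rw [← hA.inv_eq_self]; exact Set.inv_mem_inv.2 hg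
  rw [show 4 = 1 + 2 + 1 from rfl, pow_add, pow_add, pow_one]
  exact Set.mul_mem_mul (Set.mul_mem_mul hg' (hPA x y hy z hz)) hg

/-- The law of `sup Δ` over `P` is invariant under scaling by every value of `Δ`; a law on the
positive reals cannot be invariant under a nontrivial scaling. -/
theorem modularCharacterFun_eq_one_of_invariant_random_set [IsProbabilityMeasure ν]
    [SMulInvariantMeasure G X ν]
    (hP : ∀ V, IsOpen V → MeasurableSet {x | (P x ∩ V).Nonempty})
    (hequiv : ∀ (g : G) (x : X), P (g • x) = g • P x) (hempty : ν {x | P x = ∅} = 0)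
    {k : ℝ} {A : Set G} (hA : IsApproximateSubgroup k A) (hl : IsLocallyFiniteSet A)
    (hPA : ∀ x, ∀ y ∈ P x, ∀ z ∈ P x, y⁻¹ * z ∈ A ^ 2) (g : G) :
    Measure.modularCharacterFun g = 1 := by
  obtain ⟨c, hc⟩ := bddAbove_modularCharacterFun hP hequiv hempty hA hl hPA
  have hc2 : ∀ h ∈ A ^ 2, Measure.modularCharacterFun h ≤ c * c := by
    rw [sq]
    rintro _ ⟨a, ha, b, hb, rfl⟩
    rw [Measure.modularCharacterFun_map_mul]
    exact mul_le_mul' (hc a ha) (hc b hb)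
  have hA2 := IsApproximateSubgroup.isLocallyFiniteSet_pow hA hl 1
  let Δ : G → ENNReal := fun g => Measure.modularCharacterFun g
  have hΔmul : ∀ g h, Δ (g * h) = Δ g * Δ h := fun g h => by
    simp only [Δ, Measure.modularCharacterFun_map_mul, ENNReal.coe_mul]
  have hΔpow : ∀ (g : G) (n : ℕ), Δ (g ^ n) = Δ g ^ n := fun g n => by
    simp only [Δ, modularCharacterFun_pow, ENNReal.coe_pow]
  -- `E t` is the event that the supremum of the modular character on `P` exceeds `t`.
  let E : ENNReal → Set X := fun t => {x | (P x ∩ Δ ⁻¹' Set.Ioi t).Nonempty}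
  have hE : ∀ t, MeasurableSet (E t) := fun t => measurableSet_inter_nonempty hP
    (fun x => isLocallyFiniteSet_of_inv_mul_mem hA2 (hPA x))
    (measurable_modularCharacterFun measurableSet_Ioi)
  have hEanti : Antitone E := fun s t hst x ⟨y, hy, hyt⟩ => ⟨y, hy, lt_of_le_of_lt hst hyt⟩
  have hEsmul : ∀ (h : G) t, ν (E (Δ h * t)) = ν (E t) := by
    intro h t
    rw [← measure_preimage_smul ν h]
    congr 1
    ext x
    have hΔh : ∀ y, Δ h * t < Δ (h * y) ↔ t < Δ y := fun y => by
      rw [hΔmul]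
      exact ENNReal.mul_lt_mul_iff_right
        (ENNReal.coe_ne_zero.2 (Measure.modularCharacterFun_pos h).ne') ENNReal.coe_ne_top
    constructor
    · rintro ⟨_, hy, hyt⟩
      rw [hequiv] at hy
      obtain ⟨y, hy, rfl⟩ := hy
      exact ⟨y, hy, (hΔh y).1 hyt⟩
    · rintro ⟨y, hy, hyt⟩
      exact ⟨h * y, by rw [hequiv]; exact ⟨y, hy, rfl⟩, (hΔh y).2 hyt⟩
  refine modularCharacterFun_eq_one_of_forall_not_one_lt (fun g hg => ?_) g
  have hgpow : ∀ b : NNReal, ∃ n : ℕ, (b : ENNReal) < Δ (g ^ n) := fun b => by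
    obtain ⟨n, hn⟩ := pow_unbounded_of_one_lt b hg
    exact ⟨n, by rw [hΔpow]; simp only [Δ]; exact_mod_cast hn⟩
  have hE1 : ν (E 1) = 0 := by
    have hmono : Antitone fun n : ℕ => E (Δ (g ^ n)) := fun m n hmn => by
      refine hEanti ?_
      rw [hΔpow, hΔpow]
      exact pow_le_pow_right₀ (ENNReal.one_le_coe_iff.2 hg.le) hmn
    have hlim := tendsto_measure_iInter_atTop (μ := ν) (fun n => (hE (Δ (g ^ n))).nullMeasurableSet)
      hmono ⟨0, measure_ne_top _ _⟩
    have hconst : (ν ∘ fun n : ℕ => E (Δ (g ^ n))) = fun _ => ν (E 1) := by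
      ext n
      rw [Function.comp_apply, ← hEsmul (g ^ n) 1, mul_one]
    -- On a fixed `P x` containing `y`, `Δ` is at most `Δ y * (c * c)`, so `x` leaves the events
    -- once `Δ (g ^ n)` passes this bound.
    have hinter : ⋂ n : ℕ, E (Δ (g ^ n)) = ∅ := by
      refine Set.eq_empty_of_forall_notMem fun x hx => ?_
      rw [Set.mem_iInter] at hx
      obtain ⟨y, hy, -⟩ := hx 0
      obtain ⟨n, hn⟩ := hgpow (Measure.modularCharacterFun y * (c * c))
      obtain ⟨z, hz, hzn⟩ := hx n
      have hz' : Δ z ≤ (Measure.modularCharacterFun y * (c * c) : NNReal) := by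
        rw [← mul_inv_cancel_left y z, hΔmul, ENNReal.coe_mul]
        exact mul_le_mul_right (ENNReal.coe_le_coe.2 (hc2 _ (hPA x y hy z hz))) _
      exact absurd (hn.trans hzn) (not_lt.2 hz')
    rw [hconst, hinter, measure_empty] at hlim
    exact tendsto_nhds_unique tendsto_const_nhds hlim
  -- Conversely, any point of `P x` has `Δ` above some negative power of `Δ g`; these events have
  -- the same measure as `E 1`, namely zero.
  have huniv : (Set.univ : Set X) ⊆ {x | P x = ∅} ∪ ⋃ n : ℕ, E (Δ (g ^ n)⁻¹) := by
    intro x _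
    rcases (P x).eq_empty_or_nonempty with hx | ⟨y, hy⟩
    · exact Or.inl hx
    · obtain ⟨n, hn⟩ := hgpow (Measure.modularCharacterFun y⁻¹)
      refine Or.inr (Set.mem_iUnion.2 ⟨n, y, hy, ?_⟩)
      have hΔinv : ∀ h : G, Δ h⁻¹ = (Δ h)⁻¹ := fun h => by
        refine ENNReal.eq_inv_of_mul_eq_one_left ?_
        rw [← hΔmul, inv_mul_cancel]
        simp [Δ, Measure.modularCharacterFun_map_one]
      rw [Set.mem_preimage, Set.mem_Ioi, ← inv_inv y, hΔinv, hΔinv y⁻¹, ENNReal.inv_lt_inv]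
      exact hn
  have hnull : ∀ n : ℕ, ν (E (Δ (g ^ n)⁻¹)) = 0 := fun n => by
    rw [← mul_one (Δ _), hEsmul, hE1]
  simpa using measure_mono_null huniv (measure_union_null hempty (measure_iUnion_null hnull))

end Intensity

/-! ### The hull and the strong case -/

section Hull

variable {G : Type*} [Group G] [TopologicalSpace G] [IsTopologicalGroup G]

theorem ClosedSubsets.isOpen_inter_nonempty {X : Type*} [TopologicalSpace X] {V : Set X}
    (hV : IsOpen V) : IsOpen {B : ClosedSubsets X | (B.carrier ∩ V).Nonempty} :=
  TopologicalSpace.isOpen_generateFrom_of_mem (Or.inr ⟨V, hV, rfl⟩)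

/-- As `S` is closed, a pair violating the condition has open neighbourhoods `V`, `W` all of whose
pairs violate it. Meeting both is a Chabauty–Fell open condition, so some translate of `A` would
violate it too, although `y⁻¹ * z` is unchanged by left translation. -/
theorem inv_mul_mem_of_mem_hull {A : ClosedSubsets G} {S : Set G} (hS : IsClosed S)
    (hA : ∀ y ∈ A.carrier, ∀ z ∈ A.carrier, y⁻¹ * z ∈ S) {Q : ClosedSubsets G} (hQ : Q ∈ hull A) :
    ∀ y ∈ Q.carrier, ∀ z ∈ Q.carrier, y⁻¹ * z ∈ S := by
  intro y hy z hz
  by_contra hyz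
  have hmem : {p : G × G | p.1⁻¹ * p.2 ∈ Sᶜ} ∈ 𝓝 (y, z) :=
    (hS.isOpen_compl.preimage (by fun_prop)).mem_nhds hyz
  obtain ⟨V, W, hV, hyV, hW, hzW, hVW⟩ := mem_nhds_prod_iff'.1 hmem
  obtain ⟨_, ⟨⟨_, hv, hvV⟩, ⟨_, hw, hwW⟩⟩, ⟨g, rfl⟩⟩ := mem_closure_iff.1 hQ _
    ((ClosedSubsets.isOpen_inter_nonempty hV).inter (ClosedSubsets.isOpen_inter_nonempty hW)) ⟨⟨y, hy, hyV⟩, ⟨z, hz, hzW⟩⟩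
  obtain ⟨a, ha, rfl⟩ := hv
  obtain ⟨b, hb, rfl⟩ := hw
  exact hVW (Set.mk_mem_prod hvV hwW) (by simpa [mul_assoc] using hA a ha b hb)

instance (A : ClosedSubsets G) : ContinuousConstSMul G (hull A) where
  continuous_const_smul g :=
    ((continuous_const_smul g).comp continuous_subtype_val).subtype_mk _

theorem isUnimodular_of_isStrongApproximateLattice [LocallyCompactSpace G]
    [SecondCountableTopology G] [T2Space G] [MeasurableSpace G] [BorelSpace G] {A : Set G}
    (hA : IsStrongApproximateLattice A) : IsUnimodular G := by
  obtain ⟨⟨k, hk⟩, hu, ν, hν, hinv, hempty⟩ := hA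
  have hl := hu.isLocallyFiniteSet
  have hclosed : IsClosed (A ^ 2) :=
    (IsApproximateSubgroup.isLocallyFiniteSet_pow hk hl 1).isClosed
  refine isUnimodular_of_modularCharacterFun_eq_one
    (modularCharacterFun_eq_one_of_invariant_random_set (ν := ν) (P := fun Q => Q.1.carrier)
      (fun V hV => ?_) (fun _ _ => rfl) hempty hk hl fun Q => ?_)
  · exact ((ClosedSubsets.isOpen_inter_nonempty hV).preimage continuous_subtype_val).measurableSet
  · refine inv_mul_mem_of_mem_hull hclosed (fun y hy z hz => ?_) Q.2
    rw [sq]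
    refine Set.mul_mem_mul ?_ hz
    rw [← hk.inv_eq_self]
    exact Set.inv_mem_inv.2 hy

end Hull

end ApproxLattice

theorem theorem4 {G : Type*} [Group G] [TopologicalSpace G] [IsTopologicalGroup G]
    [LocallyCompactSpace G] [SecondCountableTopology G] [T2Space G]
    [MeasurableSpace G] [BorelSpace G]
    (h : (∃ A : Set G, ApproxLattice.IsStrongApproximateLattice A) ∨
      ((∃ A : Set G, ApproxLattice.IsUniformApproximateLattice A) ∧
        ApproxLattice.IsCompactlyGeneratedGroup G)) :
    ApproxLattice.IsUnimodular G := by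
  rcases h with ⟨A, hA⟩ | ⟨⟨A, hA⟩, -⟩
  · exact ApproxLattice.isUnimodular_of_isStrongApproximateLattice hA
  · exact ApproxLattice.isUnimodular_of_isUniformApproximateLattice hA
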